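/- Let $2\le p<\infty$. Let $S^p$ be the Schatten class of all compact operators $x$ on $\ell^2$ with $\|x\|_{S^p}=\big(\mathrm{Tr}\,(x^*x)^{p/2}\big)^{1/p}<\infty$. For a linear map $T$ and $x\in S^p$ put $x_k=k^{1/2}\,T^{k-1}(I-T)x$, $k\ge 1$. If all $x_k$ belong to $S^p$ and $\sum_k x_k\otimes e_k$ converges in $S^p(\ell^2_c)$, the completion of $S^p\otimes\ell^2$ for the norm determined by $\big\|\sum_{k\le n} x_k\otimes e_k\big\|_{S^p(\ell^2_c)}=\big\|\big(\sum_{k\le n} x_k^*x_k\big)^{1/2}\big\|_{S^p}$, let $\|x\|_{p,T,c,1}$ be the norm of its sum; otherwise let $\|x\|_{p,T,c,1}=\infty$. Define $\|x\|_{p,T,r,1}$ in the same way with $x_kx_k^*$ in place of $x_k^*x_k$. Let $a$ be the bounded diagonal operator on $\ell^2$ with $a e_k=(1-2^{-k})e_k$, $k\ge1$, and let $\mathcal L_a x=ax$ and $\mathcal R_a x=xa$ be the left and right multiplications by $a$. Then for every $x\in S^p$ $$\tfrac12\|x\|_{S^p}\le\|x\|_{p,\mathcal L_a,c,1}\le\|x\|_{S^p}\qquad\text{and}\qquad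 \tfrac12\|x\|_{S^p}\le\|x\|_{p,\mathcal R_a,r,1}\le\|x\|_{S^p}.$$ Moreover, for every $x\in S^p$ and every $0<\varrho<1$ the operator $I+\varrho a$ is invertible and $$\|x\|_{p,\varrho\mathcal L_a,c,1}=\|(I+\varrho a)^{-1}x\|_{S^p}.$$ -/

import Mathlib

open scoped ENNReal

/-- The Hilbert space `ℓ²` of square summable complex sequences, indexed by `ℕ = {0, 1, 2, …}`. It
is made a type of its own, with the Hilbert space structure of `lp`, so that the instances on it are
those of an abstract Hilbert space. -/
def EllTwo : Type := lp (fun _ : ℕ => ℂ) 2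

noncomputable instance instEllTwoNormed : NormedAddCommGroup EllTwo :=
  inferInstanceAs (NormedAddCommGroup (lp (fun _ : ℕ => ℂ) 2))

noncomputable instance instEllTwoInner : InnerProductSpace ℂ EllTwo :=
  inferInstanceAs (InnerProductSpace ℂ (lp (fun _ : ℕ => ℂ) 2))

instance instEllTwoComplete : CompleteSpace EllTwo :=
  inferInstanceAs (CompleteSpace (lp (fun _ : ℕ => ℂ) 2))

/-- The algebra `B(ℓ²)` of bounded operators on `ℓ²`. -/
abbrev BEllTwo : Type := EllTwo →L[ℂ] EllTwo

/-- The identity map between `EllTwo` and `lp`, which gives the coordinates of a vector. -/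
noncomputable def ellCoord : EllTwo ≃ₗᵢ[ℂ] lp (fun _ : ℕ => ℂ) 2 :=
  LinearIsometryEquiv.refl ℂ (lp (fun _ : ℕ => ℂ) 2)

/-- The canonical basis of `ℓ²`; `ellBasis j` is the vector that is written `e_{j+1}` when the
basis is indexed by the integers `k ≥ 1`. -/
noncomputable def ellBasis : HilbertBasis ℕ ℂ EllTwo := HilbertBasis.ofRepr ellCoord

/-- The canonical trace `Tr A = ∑_j ⟨e_j, A e_j⟩ ∈ [0, ∞]` of a positive operator `A`. -/
noncomputable def posTrace (A : BEllTwo) : ℝ≥0∞ :=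
  ∑' j : ℕ, ENNReal.ofReal (inner ℂ (ellBasis j) (A (ellBasis j))).re

/-- `‖x‖_{S^p} = (Tr (x* x)^{p/2})^{1/p} ∈ [0, ∞]` for `x ∈ B(ℓ²)` and `0 < p < ∞`; the power
`(x* x)^{p/2}` is taken in the continuous functional calculus. -/
noncomputable def schattenNorm (p : ℝ) (x : BEllTwo) : ℝ≥0∞ :=
  posTrace ((star x * x) ^ (p / 2)) ^ (1 / p)

/-- The Schatten class `S^p`: the compact operators on `ℓ²` with finite `S^p`-norm. -/
def schattenClass (p : ℝ) : Set BEllTwo :=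
  {x | IsCompactOperator x ∧ schattenNorm p x < ∞}

/-- `‖∑_{k ∈ s} x_k ⊗ e_k‖_{S^p(ℓ²_c)} = ‖(∑_{k ∈ s} |x_k|²)^{1/2}‖_{S^p}`, with
`|x_k|² = x_k* x_k`, for a finite set `s` of indices. -/
noncomputable def finColNorm (p : ℝ) (s : Finset ℕ) (x : ℕ → BEllTwo) : ℝ≥0∞ :=
  schattenNorm p (CFC.sqrt (∑ k ∈ s, star (x k) * x k))

/-- `‖∑_{k ∈ s} x_k ⊗ e_k‖_{S^p(ℓ²_r)} = ‖(∑_{k ∈ s} |x_k*|²)^{1/2}‖_{S^p}`, with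
`|x_k*|² = x_k x_k*`, for a finite set `s` of indices. -/
noncomputable def finRowNorm (p : ℝ) (s : Finset ℕ) (x : ℕ → BEllTwo) : ℝ≥0∞ :=
  schattenNorm p (CFC.sqrt (∑ k ∈ s, x k * star (x k)))

/-- The sequence `x` belongs to `S^p(ℓ²_c)`, the completion of `S^p ⊗ ℓ²` for the column norm: all
its terms are in `S^p`, and the series `∑_k x_k ⊗ e_k` converges in the completion, that is, its
partial sums are Cauchy for the column norm. -/
def MemCol (p : ℝ) (x : ℕ → BEllTwo) : Prop :=
  (∀ k, x k ∈ schattenClass p) ∧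
    ∀ ε : ℝ≥0∞, 0 < ε → ∃ N : ℕ, ∀ m n : ℕ, N ≤ m → m ≤ n → finColNorm p (Finset.Ico m n) x < ε

/-- The sequence `x` belongs to `S^p(ℓ²_r)`, the completion of `S^p ⊗ ℓ²` for the row norm. -/
def MemRow (p : ℝ) (x : ℕ → BEllTwo) : Prop :=
  (∀ k, x k ∈ schattenClass p) ∧
    ∀ ε : ℝ≥0∞, 0 < ε → ∃ N : ℕ, ∀ m n : ℕ, N ≤ m → m ≤ n → finRowNorm p (Finset.Ico m n) x < ε

open scoped Classical in
/-- The norm of `x` in `S^p(ℓ²_c)`, which is the limit of the norms of the partial sums (these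
increase, so the limit is their supremum); it is `∞` when `x` is not in `S^p(ℓ²_c)`. -/
noncomputable def colNorm (p : ℝ) (x : ℕ → BEllTwo) : ℝ≥0∞ :=
  if MemCol p x then ⨆ n : ℕ, finColNorm p (Finset.range n) x else ∞

open scoped Classical in
/-- The norm of `x` in `S^p(ℓ²_r)`, which is the limit of the norms of the partial sums (these
increase, so the limit is their supremum); it is `∞` when `x` is not in `S^p(ℓ²_r)`. -/
noncomputable def rowNorm (p : ℝ) (x : ℕ → BEllTwo) : ℝ≥0∞ :=
  if MemRow p x then ⨆ n : ℕ, finRowNorm p (Finset.range n) x else ∞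

/-- The sequence `k^{1/2} T^{k-1} (I - T) x = k^{1/2} (T^{k-1} x - T^k x)`, `k ≥ 1`; the index
`j` of the code is `k - 1`. -/
noncomputable def squareSeq (T : Module.End ℂ BEllTwo) (x : BEllTwo) (j : ℕ) : BEllTwo :=
  ((Real.sqrt ((j : ℝ) + 1) : ℝ) : ℂ) • (T ^ j) ((1 - T) x)

/-- The column square function `‖x‖_{p,T,c,1} ∈ [0, ∞]`. -/
noncomputable def colSquare (p : ℝ) (T : Module.End ℂ BEllTwo) (x : BEllTwo) : ℝ≥0∞ :=
  colNorm p (squareSeq T x)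

/-- The row square function `‖x‖_{p,T,r,1} ∈ [0, ∞]`. -/
noncomputable def rowSquare (p : ℝ) (T : Module.End ℂ BEllTwo) (x : BEllTwo) : ℝ≥0∞ :=
  rowNorm p (squareSeq T x)

/-- The diagonal entries `1 - 2^{-k}`, `k ≥ 1`, with `k = j + 1`. -/
noncomputable def diagEntry (j : ℕ) : ℝ := 1 - (2 ^ (j + 1))⁻¹

theorem diagEntry_norm_le (j : ℕ) : ‖(diagEntry j : ℂ)‖ ≤ 1 := by
  have h1 : (1 : ℝ) ≤ 2 ^ (j + 1) := one_le_pow₀ (by norm_num)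
  have h2 : ((2 : ℝ) ^ (j + 1))⁻¹ ≤ 1 := inv_le_one_of_one_le₀ h1
  have h3 : 0 < ((2 : ℝ) ^ (j + 1))⁻¹ := by positivity
  rw [Complex.norm_real, Real.norm_eq_abs, abs_le, diagEntry]
  constructor <;> linarith

theorem diag_norm_le (x : lp (fun _ : ℕ => ℂ) 2) (j : ℕ) :
    ‖(diagEntry j : ℂ) * x j‖ ≤ ‖x j‖ := by
  rw [norm_mul]
  exact mul_le_of_le_one_left (norm_nonneg _) (diagEntry_norm_le j)

/-- The diagonal operator `a (∑ x_k e_k) = ∑ (1 - 2^{-k}) x_k e_k` on `ℓ²`. -/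
noncomputable def diagOp : BEllTwo :=
  LinearMap.mkContinuous
    { toFun := fun x => ellCoord.symm ⟨fun j => (diagEntry j : ℂ) * ellCoord x j,
        (lp.memℓp (ellCoord x)).mono' (diag_norm_le _)⟩
      map_add' := fun x y => by
        rw [← map_add]
        congr 1
        ext j
        simp only [map_add, lp.coeFn_add, Pi.add_apply, mul_add]
      map_smul' := fun c x => by
        rw [RingHom.id_apply, ← map_smul]
        congr 1
        ext j
        simp only [map_smul, lp.coeFn_smul, Pi.smul_apply, smul_eq_mul]
        ring }
    1 (fun x => by
      rw [one_mul, LinearMap.coe_mk, AddHom.coe_mk, LinearIsometryEquiv.norm_map,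
        ← ellCoord.norm_map x]
      exact lp.norm_mono (by norm_num) (diag_norm_le _))

/-- Left multiplication `ℒ_a x = a x`. -/
noncomputable def leftMul (a : BEllTwo) : Module.End ℂ BEllTwo := LinearMap.mulLeft ℂ a

/-- Right multiplication `ℛ_a x = x a`. -/
noncomputable def rightMul (a : BEllTwo) : Module.End ℂ BEllTwo := LinearMap.mulRight ℂ a

/-! Let `b` be diagonal with entries `l j` in `[0, 1)`. All the operators `b ^ k * (1 - b)` are
diagonal, so a finite sum of the squares of the terms is `x* F² x`, where `F` is diagonal with `F²`
a partial sum of `∑ k l^(2(k-1)) (1-l)² = (1+l)⁻²`. The column norm of a partial sum is therefore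
the Schatten norm of `F x`, and the square function should be that of `(1 + b)⁻¹ x`. This identity
is `colSquare_leftMul_of_isDiagonal`; the two-sided estimate follows from `1 ≤ 1 + a ≤ 2`, and the
row case by adjoints.

The work lies in the limit, because `F` need not converge in operator norm when `l j → 1`.
Membership in the completion rests on the Berezin–Jensen inequality `Tr (K T K*)^q ≤ Tr (K T^q K*)`:
for diagonal `K` its right side is a weighted sum of the diagonal entries of `(x x*)^(p/2)`, to
which dominated convergence applies. The value of the norm comes from contractivity in one
direction, and in the other from lower semicontinuity, since compactness of `x` turns strong
convergence of `F` into norm convergence of `F x`. -/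

/-! ### Functional calculus and compact operators on a Hilbert space. -/

section Hilbert

universe u

variable {H : Type u} {G : Type*} [NormedAddCommGroup H] [InnerProductSpace ℂ H] [CompleteSpace H]
  [NormedAddCommGroup G] [InnerProductSpace ℂ G] [CompleteSpace G]

/-- The relation passes to polynomials, then to continuous functions by Stone–Weierstrass on the
union of the two spectra, a compact set carrying both calculi. -/
theorem cfc_comp_eq_comp_cfc {A : H →L[ℂ] H} {B : G →L[ℂ] G} {X : G →L[ℂ] H}
    (hA : IsSelfAdjoint A) (hB : IsSelfAdjoint B) (h : A ∘L X = X ∘L B) {f : ℝ → ℝ}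
    (hf : Continuous f) : cfc f A ∘L X = X ∘L cfc f B := by
  let s : Set ℝ := spectrum ℝ A ∪ spectrum ℝ B
  have hsA : spectrum ℝ A ⊆ s := Set.subset_union_left
  have hsB : spectrum ℝ B ⊆ s := Set.subset_union_right
  have hs : IsCompact s :=
    (ContinuousFunctionalCalculus.isCompact_spectrum (R := ℝ) A).union
      (ContinuousFunctionalCalculus.isCompact_spectrum (R := ℝ) B)
  have : CompactSpace s := isCompact_iff_compactSpace.mp hs
  have key (g : C(s, ℝ)) : cfcHomSuperset hA hsA g ∘L X = X ∘L cfcHomSuperset hB hsB g := by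
    induction g using ContinuousMap.induction_on_of_compact with
    | const r =>
      have : ContinuousMap.const s r = algebraMap ℝ C(s, ℝ) r := rfl
      rw [this, AlgHomClass.commutes, AlgHomClass.commutes]
      ext v
      simp [Algebra.algebraMap_eq_smul_one]
    | id => simpa only [cfcHomSuperset_id] using h
    | star_id => simpa only [map_star, cfcHomSuperset_id, hA.star_eq, hB.star_eq] using h
    | add f g hf hg => rw [map_add, map_add, ContinuousLinearMap.add_comp, hf, hg,
        ContinuousLinearMap.comp_add]
    | mul f g hf hg =>
      rw [map_mul, map_mul, ContinuousLinearMap.mul_def, ContinuousLinearMap.comp_assoc, hg,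
        ← ContinuousLinearMap.comp_assoc, hf, ContinuousLinearMap.mul_def,
        ContinuousLinearMap.comp_assoc]
    | frequently g hg =>
      have hcA := cfcHomSuperset_continuous hA hsA
      have hcB := cfcHomSuperset_continuous hB hsB
      have : IsClosed {g : C(s, ℝ) | cfcHomSuperset hA hsA g ∘L X = X ∘L cfcHomSuperset hB hsB g} :=
        isClosed_eq (hcA.clm_comp continuous_const) (continuous_const.clm_comp hcB)
      exact this.mem_of_frequently_of_tendsto hg Filter.tendsto_id
  have hfA : cfc f A = cfcHomSuperset hA hsA ⟨fun t => f t, by fun_prop⟩ := by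
    rw [cfc_apply f A, cfcHomSuperset_apply]
    rfl
  have hfB : cfc f B = cfcHomSuperset hB hsB ⟨fun t => f t, by fun_prop⟩ := by
    rw [cfc_apply f B, cfcHomSuperset_apply]
    rfl
  rw [hfA, hfB, key]

theorem rpow_comp_eq_comp_rpow {A : H →L[ℂ] H} {B : G →L[ℂ] G} {X : G →L[ℂ] H}
    (hA : 0 ≤ A) (hB : 0 ≤ B) (h : A ∘L X = X ∘L B) {q : ℝ} (hq : 0 ≤ q) :
    (A ^ q) ∘L X = X ∘L (B ^ q) := by
  rw [CFC.rpow_eq_cfc_real, CFC.rpow_eq_cfc_real]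
  exact cfc_comp_eq_comp_cfc (.of_nonneg hA) (.of_nonneg hB) h (Real.continuous_rpow_const hq)

theorem rpow_apply_of_apply_eq_smul {A : H →L[ℂ] H} (hA : 0 ≤ A) {l : ℝ} {v : H}
    (h : A v = (l : ℂ) • v) {q : ℝ} (hq : 0 ≤ q) : (A ^ q) v = ((l ^ q : ℝ) : ℂ) • v := by
  -- An eigenvector, seen as an operator `ℂ → H`, intertwines `A` with the scalar `l`.
  have key := cfc_comp_eq_comp_cfc (A := A) (B := algebraMap ℝ (ℂ →L[ℂ] ℂ) l)
    (X := ContinuousLinearMap.toSpanSingleton ℂ v) (.of_nonneg hA)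
    (IsSelfAdjoint.algebraMap _ (.all l)) (by ext; simp [h, Algebra.algebraMap_eq_smul_one]) (Real.continuous_rpow_const hq)
  rw [CFC.rpow_eq_cfc_real]
  rw [cfc_algebraMap] at key
  simpa [Algebra.algebraMap_eq_smul_one] using congr($key 1)

omit [CompleteSpace H] in
theorem re_inner_nonneg_of_nonneg {A : H →L[ℂ] H} (hA : 0 ≤ A) (v : H) :
    0 ≤ (inner ℂ v (A v)).re :=
  ((ContinuousLinearMap.nonneg_iff_isPositive A).mp hA).re_inner_nonneg_right v

theorem re_inner_mono {A B : H →L[ℂ] H} (h : A ≤ B) (v : H) :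
    (inner ℂ v (A v)).re ≤ (inner ℂ v (B v)).re := by
  have := re_inner_nonneg_of_nonneg (sub_nonneg.mpr h) v
  simpa [inner_sub_right] using this

/-- Jensen's inequality for the powers of a positive operator. -/
theorem re_inner_rpow_le {A : H →L[ℂ] H} (hA : 0 ≤ A) {q : ℝ} (hq : 1 ≤ q) {v : H}
    (hv : ‖v‖ ≤ 1) : (inner ℂ v (A v)).re ^ q ≤ (inner ℂ v ((A ^ q) v)).re := by
  set s := (inner ℂ v (A v)).re with hs
  have hs0 : 0 ≤ s := re_inner_nonneg_of_nonneg hA v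
  -- By convexity `t ^ q` lies above its tangent at `s`; the functional calculus makes this an
  -- operator inequality.
  have tangent (t : ℝ) (ht : 0 ≤ t) : q * s ^ (q - 1) * t - (q - 1) * s ^ q ≤ t ^ q := by
    rcases hs0.eq_or_lt with h0 | hpos
    · rw [← h0, Real.zero_rpow (by linarith : q ≠ 0)]
      rcases hq.eq_or_lt with h1 | h1
      · simp [← h1]
      · rw [Real.zero_rpow (by linarith : q - 1 ≠ 0)]
        simpa using Real.rpow_nonneg ht q
    · have h1 := one_add_mul_self_le_rpow_one_add (s := t / s - 1)
        (by have := div_nonneg ht hs0; linarith) hq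
      have h2 : (1 + (t / s - 1)) = t / s := by ring
      rw [h2, Real.div_rpow ht hs0, le_div_iff₀ (Real.rpow_pos_of_pos hpos q)] at h1
      refine le_trans (le_of_eq ?_) h1
      rw [Real.rpow_sub_one hpos.ne']
      field_simp
      ring
  have hle : (q * s ^ (q - 1)) • A - ((q - 1) * s ^ q) • (1 : H →L[ℂ] H) ≤ A ^ q := by
    rw [CFC.rpow_eq_cfc_real]
    have hsa : IsSelfAdjoint A := .of_nonneg hA
    have h1 : (q * s ^ (q - 1)) • A - ((q - 1) * s ^ q) • (1 : H →L[ℂ] H)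
        = cfc (fun t : ℝ => q * s ^ (q - 1) * t - (q - 1) * s ^ q) A := by
      rw [cfc_sub _ _, cfc_const_mul_id _ _, cfc_const _ _, Algebra.algebraMap_eq_smul_one]
    rw [h1]
    refine cfc_mono (fun t ht => tangent t (spectrum_nonneg_of_nonneg hA ht)) ?_ ?_
    · fun_prop
    · exact (Real.continuous_rpow_const (by linarith)).continuousOn
  have h3 := re_inner_mono hle v
  have h4 : (inner ℂ v (((q * s ^ (q - 1)) • A - ((q - 1) * s ^ q) • (1 : H →L[ℂ] H)) v)).re
      = q * s ^ (q - 1) * s - (q - 1) * s ^ q * ‖v‖ ^ 2 := by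
    simp only [sub_apply, smul_apply, inner_sub_right,
      one_apply_eq_self, Complex.sub_re, inner_smul_right_eq_smul, Complex.smul_re,
      smul_eq_mul, inner_self_eq_norm_sq_to_K]
    rw [← hs]
    norm_cast
  rw [h4] at h3
  refine le_trans ?_ h3
  have h5 : s ^ (q - 1) * s = s ^ q := by
    rcases hs0.eq_or_lt with h0 | hpos
    · rw [← h0, Real.zero_rpow (by linarith : q ≠ 0), mul_zero]
    · rw [Real.rpow_sub_one hpos.ne']; field_simp
  -- The constant term of the tangent is nonpositive, so `‖v‖ ≤ 1` suffices in place of a unit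
  -- vector.
  have h6 : ‖v‖ ^ 2 ≤ 1 := pow_le_one₀ (norm_nonneg v) hv
  have h7 : 0 ≤ s ^ q := Real.rpow_nonneg hs0 q
  rw [mul_assoc, h5]
  nlinarith [mul_nonneg (mul_nonneg (sub_nonneg.mpr hq) h7) (sub_nonneg.mpr h6)]

/-- Orthonormal bases of all the eigenspaces, the kernel included, are glued together; the spectral
theorem for compact operators says that nothing is orthogonal to them. -/
theorem exists_hilbertBasis_eigenvectors {A : H →L[ℂ] H} (hA : 0 ≤ A)
    (hc : IsCompactOperator A) :
    ∃ (ι : Type u) (f : HilbertBasis ι ℂ H) (l : ι → ℝ),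
      (∀ i, 0 ≤ l i) ∧ ∀ i, A (f i) = (l i : ℂ) • f i := by
  have hsym : (A : H →ₗ[ℂ] H).IsSymmetric :=
    ((ContinuousLinearMap.nonneg_iff_isPositive A).mp hA).isSymmetric
  let V (μ : ℂ) : Submodule ℂ H := Module.End.eigenspace (A : Module.End ℂ H) μ
  have hV (μ : ℂ) : CompleteSpace (V μ) := by
    have : V μ = (A - μ • (1 : H →L[ℂ] H)).ker := by
      ext v
      simp [V, sub_eq_zero]
    rw [this]
    exact (ContinuousLinearMap.isClosed_ker _).completeSpace_coe
  choose w b _ using fun μ => exists_hilbertBasis ℂ (V μ)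
  have ho := hsym.orthogonalFamily_eigenspaces.orthonormal_sigma_orthonormal
    (v_family := fun μ => (b μ : w μ → V μ)) (fun μ => (b μ).orthonormal)
  have hspan : (Submodule.span ℂ (Set.range fun a : Σ μ, w μ => ((b a.1 a.2 : V a.1) : H)))ᗮ
      = ⊥ := by
    rw [eq_bot_iff, ← ContinuousLinearMap.orthogonalComplement_iSup_eigenspaces_eq_bot hc hsym,
      ← Submodule.orthogonal_closure (Submodule.span _ _)]
    refine Submodule.orthogonal_le (iSup_le fun μ v hv => ?_)
    have h1 : (⟨v, hv⟩ : V μ) ∈ (Submodule.span ℂ (Set.range (b μ))).topologicalClosure := by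
      rw [(b μ).dense_span]; trivial
    refine closure_mono ?_ (image_closure_subset_closure_image continuous_subtype_val
      ⟨⟨v, hv⟩, h1, rfl⟩)
    rintro _ ⟨u, hu, rfl⟩
    have h3 : (V μ).subtype u ∈ (Submodule.span ℂ (Set.range (b μ))).map (V μ).subtype :=
      ⟨u, hu, rfl⟩
    rw [Submodule.map_span] at h3
    refine Submodule.span_mono ?_ h3
    rintro _ ⟨_, ⟨i, rfl⟩, rfl⟩
    exact ⟨⟨μ, i⟩, rfl⟩
  let f : HilbertBasis (Σ μ, w μ) ℂ H := HilbertBasis.mkOfOrthogonalEqBot ho hspan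
  have hf (a : Σ μ, w μ) : f a = ((b a.1 a.2 : V a.1) : H) := by
    exact congrFun (HilbertBasis.coe_mkOfOrthogonalEqBot ho hspan) a
  have hfe (a : Σ μ, w μ) : A (f a) = a.1 • f a := by
    rw [hf]
    exact Module.End.mem_eigenspace_iff.mp (b a.1 a.2).2
  have hre (a : Σ μ, w μ) : a.1 = ((a.1.re : ℝ) : ℂ) := by
    refine (Complex.conj_eq_iff_re.mp (hsym.conj_eigenvalue_eq_self ?_)).symm
    refine Module.End.hasEigenvalue_of_hasEigenvector (x := f a) ⟨?_, f.orthonormal.ne_zero a⟩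
    exact Module.End.mem_eigenspace_iff.mpr (hfe a)
  refine ⟨_, f, fun a : Σ μ, w μ => a.1.re, fun a => ?_, fun a => by
    rw [← hre a]; exact hfe a⟩
  have h := re_inner_nonneg_of_nonneg hA (f a)
  rw [hfe, inner_smul_right, inner_self_eq_norm_sq_to_K, f.orthonormal.1] at h
  simpa using h

/-- Schauder's theorem. Since `‖x* w‖² = ⟨w, x x* w⟩ ≤ ‖w‖ ‖x x* w‖` and differences of unit ball
vectors have norm at most 2, an `ε²/2`-net for the image of the ball under `x x*` gives an `ε`-net
for its image under `x*`. -/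
theorem isCompactOperator_star {x : H →L[ℂ] H} (hx : IsCompactOperator x) :
    IsCompactOperator (star x : H →L[ℂ] H) := by
  have hxx : IsCompactOperator (x * star x : H →L[ℂ] H) := hx.comp_clm (star x)
  rw [← ContinuousLinearMap.coe_coe,
    isCompactOperator_iff_isCompact_closure_image_closedBall _ one_pos]
  refine TotallyBounded.isCompact_of_isClosed ?_ isClosed_closure
  refine TotallyBounded.closure (Metric.totallyBounded_iff.mpr fun ε hε => ?_)
  have hb : TotallyBounded ((x * star x : H →L[ℂ] H) '' Metric.closedBall 0 1) :=
    (hxx.isCompact_closure_image_closedBall (f := ((x * star x : H →L[ℂ] H) : H →ₗ[ℂ] H))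
      1).totallyBounded.subset subset_closure
  obtain ⟨t, hts, htf, ht⟩ := Metric.finite_approx_of_totallyBounded hb (ε ^ 2 / 2) (by positivity)
  have hts' : ∀ c ∈ t, ∃ u ∈ Metric.closedBall (0 : H) 1, (x * star x : H →L[ℂ] H) u = c := hts
  choose! g hg using hts'
  refine ⟨(star x : H →L[ℂ] H) ∘ g '' t, htf.image _, ?_⟩
  rintro _ ⟨v, hv, rfl⟩
  obtain ⟨c, hc, hvc⟩ := Set.mem_iUnion₂.mp (ht ⟨v, hv, rfl⟩)
  refine Set.mem_iUnion₂.mpr ⟨_, ⟨c, hc, rfl⟩, ?_⟩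
  obtain ⟨hgc, hgx⟩ := hg c hc
  rw [mem_closedBall_zero_iff] at hv hgc
  rw [Metric.mem_ball, dist_eq_norm] at hvc ⊢
  rw [← hgx, ← map_sub] at hvc
  simp only [ContinuousLinearMap.coe_coe, Function.comp_apply]
  rw [← map_sub]
  refine lt_of_pow_lt_pow_left₀ 2 hε.le ?_
  have h1 : ‖(star x : H →L[ℂ] H) (v - g c)‖ ^ 2
      = (inner ℂ (v - g c) ((x * star x : H →L[ℂ] H) (v - g c))).re := by
    rw [ContinuousLinearMap.mul_def, ContinuousLinearMap.comp_apply, ContinuousLinearMap.star_eq_adjoint,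
      ← ContinuousLinearMap.adjoint_inner_left, inner_self_eq_norm_sq_to_K]
    norm_cast
  rw [h1]
  calc _ ≤ ‖v - g c‖ * ‖(x * star x : H →L[ℂ] H) (v - g c)‖ := re_inner_le_norm (𝕜 := ℂ) _ _
    _ ≤ 2 * ‖(x * star x : H →L[ℂ] H) (v - g c)‖ := by
      gcongr
      linarith [norm_sub_le v (g c)]
    _ < ε ^ 2 := by linarith

omit [CompleteSpace H] in
-- Strong convergence of a bounded sequence is uniform on the totally bounded image of the unit ball
-- under `x`.
theorem tendsto_clm_mul_of_isCompactOperator {x : H →L[ℂ] H} (hx : IsCompactOperator x)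
    {K : ℕ → H →L[ℂ] H} {L : H →L[ℂ] H} {C : ℝ} (hK : ∀ n, ‖K n - L‖ ≤ C)
    (hlim : ∀ v, Filter.Tendsto (fun n => K n v) Filter.atTop (nhds (L v))) :
    Filter.Tendsto (fun n => K n * x) Filter.atTop (nhds (L * x)) := by
  have hC : 0 ≤ C := (norm_nonneg _).trans (hK 0)
  rw [Metric.tendsto_atTop']
  intro ε hε
  have hb : TotallyBounded (x '' Metric.closedBall 0 1) :=
    (hx.isCompact_closure_image_closedBall (f := (x : H →ₗ[ℂ] H)) 1).totallyBounded.subset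
      subset_closure
  obtain ⟨t, htf, ht⟩ := Metric.totallyBounded_iff.mp hb (ε / (4 * (C + 1))) (by positivity)
  have hev : ∀ᶠ n in Filter.atTop, ∀ c ∈ t, dist (K n c) (L c) < ε / 4 :=
    (Filter.eventually_all_finite htf).mpr fun c _ =>
      (Metric.tendsto_nhds.mp (hlim c)) _ (by positivity)
  obtain ⟨N, hN⟩ := Filter.eventually_atTop.mp hev
  refine ⟨N, fun n hn => ?_⟩
  rw [dist_eq_norm]
  refine lt_of_le_of_lt (b := ε / 2) ?_ (by linarith)
  refine ContinuousLinearMap.opNorm_le_of_unit_norm (by positivity) fun v hv => ?_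
  obtain ⟨c, hc, hvc⟩ := Set.mem_iUnion₂.mp (ht ⟨v, by simp [hv], rfl⟩)
  rw [Metric.mem_ball, dist_eq_norm] at hvc
  have h1 : (K n * x - L * x) v = (K n - L) (x v - c) + (K n c - L c) := by
    simp
    abel
  have h2 := hN n hn.le c hc
  rw [dist_eq_norm] at h2
  rw [h1]
  calc _ ≤ ‖(K n - L) (x v - c)‖ + ‖K n c - L c‖ := norm_add_le _ _
    _ ≤ C * (ε / (4 * (C + 1))) + ε / 4 := by
      gcongr
      exact ((K n - L).le_opNorm _).trans (mul_le_mul (hK n) hvc.le (norm_nonneg _) hC)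
    _ ≤ ε / 4 + ε / 4 := by
      gcongr
      rw [← mul_div_assoc, div_le_div_iff₀ (by positivity) (by positivity)]
      nlinarith
    _ = ε / 2 := by ring

end Hilbert

/-! ### The trace and its inequalities for powers. -/

section Trace

universe u

variable {H : Type u} [NormedAddCommGroup H] [InnerProductSpace ℂ H] [CompleteSpace H]
  {ι κ : Type*}

/-- The trace `∑ i, ⟨f i, A (f i)⟩` of a positive operator, computed in a given Hilbert basis. -/
noncomputable def basisTrace (f : HilbertBasis ι ℂ H) (A : H →L[ℂ] H) : ℝ≥0∞ :=
  ∑' i, ENNReal.ofReal (inner ℂ (f i) (A (f i))).re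

omit [CompleteSpace H] in
theorem enorm_sq_eq_tsum_inner (f : HilbertBasis ι ℂ H) (v : H) :
    ‖v‖ₑ ^ 2 = ∑' i, ‖inner ℂ (f i) v‖ₑ ^ 2 := by
  have h := f.hasSum_inner_mul_inner v v
  have h1 : HasSum (fun i => ‖inner ℂ (f i) v‖ ^ 2) (‖v‖ ^ 2) := by
    have := Complex.hasSum_re h
    rw [inner_self_eq_norm_sq_to_K] at this
    convert this using 1
    · ext i
      rw [← inner_conj_symm, RCLike.mul_conj, RCLike.norm_conj]
      norm_cast
    · norm_cast
  have h2 (z : ℝ) (hz : 0 ≤ z) : ENNReal.ofReal (z ^ 2) = (ENNReal.ofReal z) ^ 2 :=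
    ENNReal.ofReal_pow hz 2
  rw [← ofReal_norm, ← h2 _ (norm_nonneg _), ← h1.tsum_eq,
    ENNReal.ofReal_tsum_of_nonneg (fun _ => by positivity) h1.summable]
  exact tsum_congr fun i => by rw [h2 _ (norm_nonneg _), ofReal_norm]

/-- Both sides are the double sum of `|⟨g j, y (f i)⟩|²`. Traciality and independence of the basis
follow from this. -/
theorem tsum_enorm_sq_apply (f : HilbertBasis ι ℂ H) (g : HilbertBasis κ ℂ H) (y : H →L[ℂ] H) :
    ∑' i, ‖y (f i)‖ₑ ^ 2 = ∑' j, ‖(star y : H →L[ℂ] H) (g j)‖ₑ ^ 2 := by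
  simp_rw [enorm_sq_eq_tsum_inner g (y _), enorm_sq_eq_tsum_inner f ((star y : H →L[ℂ] H) _)]
  rw [ENNReal.tsum_comm]
  refine tsum_congr fun j => tsum_congr fun i => ?_
  rw [ContinuousLinearMap.star_eq_adjoint, ContinuousLinearMap.adjoint_inner_right,
    ← inner_conj_symm, RCLike.enorm_conj]

theorem basisTrace_star_mul_self (f : HilbertBasis ι ℂ H) (y : H →L[ℂ] H) :
    basisTrace f (star y * y) = ∑' i, ‖y (f i)‖ₑ ^ 2 := by
  refine tsum_congr fun i => ?_
  rw [ContinuousLinearMap.mul_def, ContinuousLinearMap.comp_apply,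
    ContinuousLinearMap.star_eq_adjoint, ContinuousLinearMap.adjoint_inner_right,
    inner_self_eq_norm_sq_to_K, ← ofReal_norm, ← ENNReal.ofReal_pow (norm_nonneg _)]
  norm_cast

theorem basisTrace_mul_star_self (f : HilbertBasis ι ℂ H) (y : H →L[ℂ] H) :
    basisTrace f (y * star y) = ∑' i, ‖(star y : H →L[ℂ] H) (f i)‖ₑ ^ 2 := by
  simpa using basisTrace_star_mul_self f (star y)

theorem basisTrace_comm (f : HilbertBasis ι ℂ H) (g : HilbertBasis κ ℂ H) (y : H →L[ℂ] H) :
    basisTrace f (star y * y) = basisTrace g (y * star y) := by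
  rw [basisTrace_star_mul_self, basisTrace_mul_star_self, tsum_enorm_sq_apply f g]

theorem basisTrace_eq (f : HilbertBasis ι ℂ H) (g : HilbertBasis κ ℂ H) {A : H →L[ℂ] H}
    (hA : 0 ≤ A) : basisTrace f A = basisTrace g A := by
  obtain ⟨y, rfl⟩ := CStarAlgebra.nonneg_iff_eq_star_mul_self.mp hA
  rw [basisTrace_comm f g, ← basisTrace_comm g g]

theorem rpow_mul_rpow {A : H →L[ℂ] H} (hA : 0 ≤ A) {r s : ℝ} (hr : 0 ≤ r) (hs : 0 ≤ s) :
    A ^ r * A ^ s = A ^ (r + s) := by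
  rw [CFC.rpow_eq_cfc_real, CFC.rpow_eq_cfc_real, CFC.rpow_eq_cfc_real,
    ← cfc_mul (fun x : ℝ => x ^ r) (fun x : ℝ => x ^ s) A
      (Real.continuous_rpow_const hr).continuousOn (Real.continuous_rpow_const hs).continuousOn]
  exact cfc_congr fun t ht =>
    (Real.rpow_add_of_nonneg (spectrum_nonneg_of_nonneg hA ht) hr hs).symm

theorem star_rpow (A : H →L[ℂ] H) (r : ℝ) : star (A ^ r) = A ^ r :=
  IsSelfAdjoint.of_nonneg (CFC.rpow_nonneg (a := A))

theorem star_mul_self_rpow_half (A : H →L[ℂ] H) (hA : 0 ≤ A) {q : ℝ} (hq : 0 ≤ q) :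
    star (A ^ (q / 2)) * A ^ (q / 2) = A ^ q := by
  rw [star_rpow, rpow_mul_rpow hA (by linarith) (by linarith), add_halves]

/-- With `R = (x x*)^((q-1)/2)`, the operator `y = R x` satisfies `y* y = (x* x)^q` and `y y* = (x
x*)^q`. -/
theorem basisTrace_rpow_comm (f : HilbertBasis ι ℂ H) (x : H →L[ℂ] H) {q : ℝ} (hq : 1 ≤ q) :
    basisTrace f ((star x * x) ^ q) = basisTrace f ((x * star x) ^ q) := by
  set A := star x * x with hA
  set B := x * star x with hB
  have hA0 : 0 ≤ A := star_mul_self_nonneg x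
  have hB0 : 0 ≤ B := mul_star_self_nonneg x
  set R := B ^ ((q - 1) / 2) with hR
  have hRs : star R = R := star_rpow _ _
  have hRR : R * R = B ^ (q - 1) := by
    rw [hR, rpow_mul_rpow hB0 (by linarith) (by linarith), add_halves]
  have h1 : A ^ q = star (R * x) * (R * x) := by
    have hint : A ^ (q - 1) * star x = star x * B ^ (q - 1) :=
      rpow_comp_eq_comp_rpow hA0 hB0
        (show A * star x = star x * B by rw [hA, hB, mul_assoc]) (by linarith)
    calc A ^ q = A ^ (q - 1) * A ^ (1 : ℝ) := by
          rw [rpow_mul_rpow hA0 (by linarith) zero_le_one, sub_add_cancel]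
      _ = A ^ (q - 1) * star x * x := by rw [CFC.rpow_one A, mul_assoc]
      _ = _ := by rw [hint, ← hRR, star_mul, hRs]; noncomm_ring
  have h2 : B ^ q = (R * x) * star (R * x) := by
    calc B ^ q = B ^ ((q - 1) / 2) * B ^ (1 : ℝ) * B ^ ((q - 1) / 2) := by
          rw [rpow_mul_rpow hB0 (by linarith) zero_le_one,
            rpow_mul_rpow hB0 (by linarith) (by linarith)]
          ring_nf
      _ = _ := by rw [CFC.rpow_one B, star_mul, hRs]; noncomm_ring
  rw [h1, h2, basisTrace_comm f f]

/-- The Berezin–Jensen trace inequality for the powers of a compact positive operator. -/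
theorem basisTrace_rpow_conj_le (g : HilbertBasis κ ℂ H) {T K : H →L[ℂ] H} (hT : 0 ≤ T)
    (hc : IsCompactOperator T) (hK : ‖K‖ ≤ 1) {q : ℝ} (hq : 1 ≤ q) :
    basisTrace g ((K * T * star K) ^ q) ≤ basisTrace g (K * T ^ q * star K) := by
  have hB : 0 ≤ K * T * star K := star_right_conjugate_nonneg hT K
  have hBc : IsCompactOperator (K * T * star K : H →L[ℂ] H) :=
    (hc.clm_comp K).comp_clm (star K)
  obtain ⟨ι, f, l, hl, hf⟩ := exists_hilbertBasis_eigenvectors hB hBc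
  have hconj (S : H →L[ℂ] H) (v : H) : inner ℂ v ((K * S * star K : H →L[ℂ] H) v)
      = inner ℂ ((star K : H →L[ℂ] H) v) (S ((star K : H →L[ℂ] H) v)) := by
    rw [ContinuousLinearMap.star_eq_adjoint, ContinuousLinearMap.adjoint_inner_left]
    rfl
  have hunit (v : H) : (inner ℂ v v).re = ‖v‖ ^ 2 := by
    rw [inner_self_eq_norm_sq_to_K]; norm_cast
  -- In an eigenbasis of `K T K*` the left trace is `∑ l i ^ q` with `l i = ⟨K* f i, T K* f i⟩`, and
  -- Jensen's inequality at `K* f i` compares the traces term by term.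
  rw [basisTrace_eq g f CFC.rpow_nonneg,
    basisTrace_eq g f (star_right_conjugate_nonneg CFC.rpow_nonneg K)]
  refine ENNReal.tsum_le_tsum fun i => ENNReal.ofReal_le_ofReal ?_
  have h1 : (inner ℂ (f i) ((K * T * star K : H →L[ℂ] H) (f i))).re = l i := by
    rw [hf, inner_smul_right, Complex.re_ofReal_mul, hunit, f.orthonormal.1]
    simp
  have h2 : (inner ℂ (f i) (((K * T * star K : H →L[ℂ] H) ^ q) (f i))).re = l i ^ q := by
    rw [rpow_apply_of_apply_eq_smul hB (hf i) (by linarith), inner_smul_right,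
      Complex.re_ofReal_mul, hunit, f.orthonormal.1]
    simp
  rw [h2, ← h1, hconj, hconj]
  refine re_inner_rpow_le hT hq ?_
  calc _ ≤ ‖(star K : H →L[ℂ] H)‖ * ‖f i‖ := ContinuousLinearMap.le_opNorm _ _
    _ ≤ 1 := by rw [norm_star, f.orthonormal.1, mul_one]; exact hK

theorem basisTrace_rpow_star_mul_le (f : HilbertBasis ι ℂ H) {x : H →L[ℂ] H}
    (hx : IsCompactOperator x) {K : H →L[ℂ] H} (hK : ‖K‖ ≤ 1) {q : ℝ} (hq : 1 ≤ q) :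
    basisTrace f ((star (K * x) * (K * x)) ^ q)
      ≤ basisTrace f (K * (x * star x) ^ q * star K) := by
  rw [basisTrace_rpow_comm f _ hq, star_mul,
    show K * x * (star x * star K) = K * (x * star x) * star K by noncomm_ring]
  exact basisTrace_rpow_conj_le f (mul_star_self_nonneg x) (hx.comp_clm (star x)) hK hq

theorem basisTrace_rpow_contraction_mul_le (f : HilbertBasis ι ℂ H) {x : H →L[ℂ] H}
    (hx : IsCompactOperator x) {K : H →L[ℂ] H} (hK : ‖K‖ ≤ 1) {q : ℝ} (hq : 1 ≤ q) :
    basisTrace f ((star (K * x) * (K * x)) ^ q) ≤ basisTrace f ((star x * x) ^ q) := by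
  refine (basisTrace_rpow_star_mul_le f hx hK hq).trans ?_
  rw [basisTrace_rpow_comm f x hq]
  set B := x * star x with hB
  have hB0 : 0 ≤ B := mul_star_self_nonneg x
  set R := B ^ (q / 2)
  have hR : star R * R = B ^ q := star_mul_self_rpow_half B hB0 (by linarith)
  have hRs : star R = R := star_rpow _ _
  have h1 : K * B ^ q * star K = (K * R) * star (K * R) := by
    rw [star_mul, ← hR, hRs]; noncomm_ring
  -- By traciality the two sides become `∑ ‖K R f i‖²` and `∑ ‖R f i‖²`.
  rw [h1, ← hR, ← basisTrace_comm f f, basisTrace_star_mul_self, basisTrace_star_mul_self]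
  refine ENNReal.tsum_le_tsum fun i => ?_
  gcongr
  refine enorm_le_iff_norm_le.mpr ?_
  exact (K.le_opNorm _).trans (mul_le_of_le_one_left (norm_nonneg _) hK)

/-- Lower semicontinuity of the trace of a power. -/
theorem basisTrace_rpow_le_of_tendsto (f : HilbertBasis ι ℂ H) {A : ℕ → H →L[ℂ] H}
    {B : H →L[ℂ] H} (hA : ∀ n, 0 ≤ A n) (hB : 0 ≤ B)
    (hlim : Filter.Tendsto A Filter.atTop (nhds B)) {q : ℝ} (hq : 0 ≤ q) {c : ℝ≥0∞}
    (hc : ∀ n, basisTrace f ((A n) ^ q) ≤ c) : basisTrace f (B ^ q) ≤ c := by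
  have hcont : ContinuousOn (fun a : H →L[ℂ] H => a ^ q) {a | 0 ≤ a} :=
    ContinuousOn.cfc_nnreal_of_mem_nhdsSet (s := Set.univ) (fun t => t ^ q) Filter.univ_mem
      continuousOn_id (fun _ h => h) (NNReal.continuous_rpow_const hq).continuousOn
  -- Powers are norm continuous on positive operators, so each finite partial sum of the trace
  -- passes to the limit.
  have hpow : Filter.Tendsto (fun n => (A n) ^ q) Filter.atTop (nhds (B ^ q)) :=
    (hcont B hB).tendsto.comp (tendsto_nhdsWithin_iff.mpr ⟨hlim, .of_forall hA⟩)
  rw [basisTrace, ENNReal.tsum_eq_iSup_sum]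
  refine iSup_le fun s => ?_
  refine le_of_tendsto (x := Filter.atTop) (f := fun n =>
    ∑ i ∈ s, ENNReal.ofReal (inner ℂ (f i) (((A n) ^ q) (f i))).re)
    (tendsto_finsetSum _ fun i _ => ?_)
    (.of_forall fun n => (ENNReal.sum_le_tsum s).trans (hc n))
  refine (ENNReal.continuous_ofReal.tendsto _).comp ?_
  refine (Complex.continuous_re.tendsto _).comp ?_
  exact tendsto_const_nhds.inner (((ContinuousLinearMap.apply ℂ H (f i)).continuous.tendsto _).comp
    hpow)

end Trace

/-! ### Real diagonal operators on `ℓ²`. -/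

section Diagonal

/-- The operator `A` is diagonal in the canonical basis of `ℓ²`, with real diagonal entries `d`. -/
def IsDiagonal (A : BEllTwo) (d : ℕ → ℝ) : Prop :=
  ∀ v j, ellCoord (A v) j = (d j : ℂ) * ellCoord v j

theorem ellTwo_ext {v w : EllTwo} (h : ∀ j, ellCoord v j = ellCoord w j) : v = w :=
  ellCoord.injective (lp.ext (funext h))

theorem ellTwo_hasSum_norm_sq (v : EllTwo) : HasSum (fun j => ‖ellCoord v j‖ ^ 2) (‖v‖ ^ 2) := by
  have h := lp.hasSum_norm (p := 2) (by norm_num) (ellCoord v)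
  simpa using h

theorem inner_ellBasis (v : EllTwo) (j : ℕ) : inner ℂ (ellBasis j) v = ellCoord v j :=
  (ellBasis.repr_apply_apply v j).symm

theorem isDiagonal_diagOp : IsDiagonal diagOp diagEntry := fun _ _ => rfl

theorem exists_isDiagonal {d : ℕ → ℝ} {C : ℝ} (hd : ∀ j, |d j| ≤ C) : ∃ A, IsDiagonal A d := by
  have hC : 0 ≤ C := (abs_nonneg _).trans (hd 0)
  have hb (w : lp (fun _ : ℕ => ℂ) 2) (j : ℕ) : ‖(d j : ℂ) * w j‖ ≤ ‖((C : ℂ) • w) j‖ := by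
    rw [lp.coeFn_smul, Pi.smul_apply, smul_eq_mul, norm_mul, norm_mul, Complex.norm_real,
      Complex.norm_real, Real.norm_eq_abs, Real.norm_eq_abs, abs_of_nonneg hC]
    exact mul_le_mul_of_nonneg_right (hd j) (norm_nonneg _)
  let m (v : EllTwo) : lp (fun _ : ℕ => ℂ) 2 :=
    ⟨fun j => (d j : ℂ) * ellCoord v j, (lp.memℓp ((C : ℂ) • ellCoord v)).mono' (hb _)⟩
  let A : EllTwo →ₗ[ℂ] EllTwo :=
    { toFun := fun v => ellCoord.symm (m v)
      map_add' := fun v w => ellTwo_ext fun j => by simp [m, mul_add]; rfl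
      map_smul' := fun c v => ellTwo_ext fun j => by simp [m]; ring }
  refine ⟨A.mkContinuous C fun v => ?_, fun v j => rfl⟩
  have h1 : ‖A v‖ = ‖m v‖ := ellCoord.symm.norm_map (m v)
  have h2 : ‖m v‖ ≤ ‖(C : ℂ) • ellCoord v‖ := lp.norm_mono (by norm_num) (hb _)
  rw [h1]
  refine h2.trans (le_of_eq ?_)
  rw [norm_smul, Complex.norm_real, Real.norm_eq_abs, abs_of_nonneg hC,
    LinearIsometryEquiv.norm_map]

namespace IsDiagonal

variable {A B : BEllTwo} {d e : ℕ → ℝ}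

theorem ext (hA : IsDiagonal A d) (hB : IsDiagonal B e) (h : ∀ j, d j = e j) : A = B := by
  ext v
  exact ellTwo_ext fun j => by rw [hA, hB, h]

theorem one : IsDiagonal 1 fun _ => 1 := fun v j => by simp

theorem zero : IsDiagonal 0 fun _ => 0 := fun v j => by simp

theorem add (hA : IsDiagonal A d) (hB : IsDiagonal B e) :
    IsDiagonal (A + B) fun j => d j + e j := fun v j => by
  simp [hA v j, hB v j, add_mul]

theorem sub (hA : IsDiagonal A d) (hB : IsDiagonal B e) :
    IsDiagonal (A - B) fun j => d j - e j := fun v j => by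
  simp [hA v j, hB v j, sub_mul]

theorem smul (hA : IsDiagonal A d) (r : ℝ) : IsDiagonal ((r : ℂ) • A) fun j => r * d j :=
  fun v j => by
    rw [smul_apply, map_smul, lp.coeFn_smul, Pi.smul_apply, smul_eq_mul, hA]
    push_cast
    ring

theorem mul (hA : IsDiagonal A d) (hB : IsDiagonal B e) :
    IsDiagonal (A * B) fun j => d j * e j := fun v j => by
  rw [ContinuousLinearMap.mul_def, ContinuousLinearMap.comp_apply, hA, hB]
  push_cast
  ring

theorem pow (hA : IsDiagonal A d) (n : ℕ) : IsDiagonal (A ^ n) fun j => d j ^ n := by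
  induction n with
  | zero => simpa using one
  | succ n ih => simpa [pow_succ] using ih.mul hA

theorem sum {A : ℕ → BEllTwo} {d : ℕ → ℕ → ℝ} (s : Finset ℕ) (h : ∀ k, IsDiagonal (A k) (d k)) :
    IsDiagonal (∑ k ∈ s, A k) fun j => ∑ k ∈ s, d k j := by
  induction s using Finset.cons_induction with
  | empty => simpa using zero
  | cons k s hk ih =>
    simp_rw [Finset.sum_cons]
    exact (h k).add ih

theorem apply_ellBasis (hA : IsDiagonal A d) (j : ℕ) : A (ellBasis j) = (d j : ℂ) • ellBasis j := by
  refine ellTwo_ext fun i => ?_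
  rw [hA, map_smul, lp.coeFn_smul, Pi.smul_apply, smul_eq_mul]
  rcases eq_or_ne i j with rfl | h
  · rfl
  · rw [← inner_ellBasis, ellBasis.orthonormal.2 h, mul_zero, mul_zero]

theorem isSelfAdjoint (hA : IsDiagonal A d) : IsSelfAdjoint A := by
  rw [ContinuousLinearMap.isSelfAdjoint_iff_isSymmetric]
  intro v w
  rw [← ellBasis.tsum_inner_mul_inner, ← ellBasis.tsum_inner_mul_inner v]
  refine tsum_congr fun j => ?_
  rw [← inner_conj_symm, inner_ellBasis, inner_ellBasis, ContinuousLinearMap.coe_coe, hA,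
    inner_ellBasis, hA, map_mul, Complex.conj_ofReal, ← inner_ellBasis v, inner_conj_symm]
  ring

theorem norm_le (hA : IsDiagonal A d) {C : ℝ} (hC : ∀ j, |d j| ≤ C) : ‖A‖ ≤ C := by
  have hC0 : 0 ≤ C := (abs_nonneg _).trans (hC 0)
  refine A.opNorm_le_bound hC0 fun v => ?_
  refine le_of_sq_le_sq ?_ (by positivity)
  rw [mul_pow]
  refine hasSum_le (fun j => ?_) (ellTwo_hasSum_norm_sq (A v))
    ((ellTwo_hasSum_norm_sq v).mul_left (C ^ 2))
  rw [hA, norm_mul, Complex.norm_real, Real.norm_eq_abs, mul_pow]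
  gcongr
  exact hC j

/-- Dominated convergence in `ℓ²`: bounded entrywise convergence gives strong convergence, without
uniformity in `j`. -/
theorem tendsto_apply {A : ℕ → BEllTwo} {d : ℕ → ℕ → ℝ} {C : ℝ}
    (hA : ∀ n, IsDiagonal (A n) (d n)) (hB : IsDiagonal B e) (hC : ∀ n j, |d n j - e j| ≤ C)
    (h : ∀ j, Filter.Tendsto (fun n => d n j) Filter.atTop (nhds (e j))) (v : EllTwo) :
    Filter.Tendsto (fun n => A n v) Filter.atTop (nhds (B v)) := by
  have hC0 : 0 ≤ C := (abs_nonneg _).trans (hC 0 0)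
  have hsq : Filter.Tendsto (fun n => ‖(A n - B) v‖ ^ 2) Filter.atTop (nhds 0) := by
    have h1 (n : ℕ) : ‖(A n - B) v‖ ^ 2 = ∑' j, |d n j - e j| ^ 2 * ‖ellCoord v j‖ ^ 2 := by
      rw [← (ellTwo_hasSum_norm_sq _).tsum_eq]
      refine tsum_congr fun j => ?_
      rw [((hA n).sub hB), norm_mul, Complex.norm_real, Real.norm_eq_abs, mul_pow]
    simp_rw [h1]
    rw [← tsum_zero (α := ℝ) (β := ℕ)]
    refine tendsto_tsum_of_dominated_convergence
      ((ellTwo_hasSum_norm_sq v).summable.mul_left (C ^ 2)) (fun j => ?_)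
      (.of_forall fun n j => ?_)
    · have h2 := (((h j).sub_const (e j)).abs.pow 2).mul_const (‖ellCoord v j‖ ^ 2)
      simpa using h2
    · rw [Real.norm_of_nonneg (by positivity)]
      gcongr
      exact hC n j
  rw [tendsto_iff_norm_sub_tendsto_zero]
  have h3 := (Real.continuous_sqrt.tendsto 0).comp hsq
  simpa [Function.comp_def, Real.sqrt_sq] using h3

end IsDiagonal

end Diagonal

/-! ### Schatten norms. -/

section Schatten

variable {p : ℝ} {x : BEllTwo}

theorem schattenNorm_eq (p : ℝ) (x : BEllTwo) :
    schattenNorm p x = basisTrace ellBasis ((star x * x) ^ (p / 2)) ^ (1 / p) := rfl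

theorem schattenNorm_star (hp : 2 ≤ p) (x : BEllTwo) :
    schattenNorm p (star x) = schattenNorm p x := by
  rw [schattenNorm_eq, schattenNorm_eq, star_star,
    basisTrace_rpow_comm _ _ (by linarith : 1 ≤ p / 2)]

theorem schattenNorm_sqrt_star_mul_self (p : ℝ) (x : BEllTwo) :
    schattenNorm p (CFC.sqrt (star x * x)) = schattenNorm p x := by
  have h : 0 ≤ star x * x := star_mul_self_nonneg x
  rw [schattenNorm_eq, (IsSelfAdjoint.of_nonneg (CFC.sqrt_nonneg (star x * x))).star_eq,
    CFC.sqrt_mul_sqrt_self _ h, schattenNorm_eq]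

theorem schattenNorm_mul_le (hp : 2 ≤ p) (hx : IsCompactOperator x) {K : BEllTwo} (hK : ‖K‖ ≤ 1) :
    schattenNorm p (K * x) ≤ schattenNorm p x :=
  ENNReal.rpow_le_rpow (basisTrace_rpow_contraction_mul_le _ hx hK (by linarith)) (by positivity)

theorem schattenNorm_smul (hp : 0 < p) {c : ℝ} (hc : 0 ≤ c) (x : BEllTwo) :
    schattenNorm p ((c : ℂ) • x) = ENNReal.ofReal c * schattenNorm p x := by
  have hA : 0 ≤ star x * x := star_mul_self_nonneg x
  have h1 : star ((c : ℂ) • x) * ((c : ℂ) • x) = (c ^ 2) • (star x * x) := by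
    rw [star_smul, smul_mul_smul_comm, ← Complex.coe_smul]
    simp [sq]
  have h2 : ((c ^ 2) • (star x * x)) ^ (p / 2) = (c ^ p) • (star x * x) ^ (p / 2) := by
    have hcont := Real.continuous_rpow_const (q := p / 2) (by positivity)
    rw [CFC.rpow_eq_cfc_real (smul_nonneg (by positivity) hA), CFC.rpow_eq_cfc_real hA,
      ← cfc_comp_const_mul _ _ _ hcont.continuousOn (.of_nonneg hA),
      ← cfc_const_mul (c ^ p) _ _ hcont.continuousOn]
    refine cfc_congr fun t ht => ?_
    rw [Real.mul_rpow (by positivity) (spectrum_nonneg_of_nonneg hA ht), ← Real.rpow_natCast,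
      ← Real.rpow_mul hc]
    congr 2
    push_cast
    ring
  have h3 (A : BEllTwo) : basisTrace ellBasis ((c ^ p) • A)
      = ENNReal.ofReal c ^ p * basisTrace ellBasis A := by
    rw [basisTrace, basisTrace, ← ENNReal.tsum_mul_left, ENNReal.ofReal_rpow_of_nonneg hc hp.le]
    refine tsum_congr fun j => ?_
    rw [← ENNReal.ofReal_mul (by positivity), smul_apply, inner_smul_right_eq_smul,
      Complex.smul_re, smul_eq_mul]
  rw [schattenNorm_eq, h1, h2, h3, ENNReal.mul_rpow_of_nonneg _ _ (by positivity),
    ← ENNReal.rpow_mul, mul_one_div_cancel hp.ne', ENNReal.rpow_one, schattenNorm_eq]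

theorem star_mem_schattenClass (hp : 2 ≤ p) (hx : x ∈ schattenClass p) :
    star x ∈ schattenClass p :=
  ⟨isCompactOperator_star hx.1, by rw [schattenNorm_star hp]; exact hx.2⟩

theorem smul_mul_mem_schattenClass (hp : 2 ≤ p) (hx : x ∈ schattenClass p) {K : BEllTwo}
    (hK : ‖K‖ ≤ 1) {c : ℝ} (hc : 0 ≤ c) : (c : ℂ) • (K * x) ∈ schattenClass p := by
  refine ⟨(hx.1.clm_comp K).smul (c : ℂ), ?_⟩
  rw [schattenNorm_smul (by linarith) hc]
  exact ENNReal.mul_lt_top ENNReal.ofReal_lt_top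
    ((schattenNorm_mul_le hp hx.1 hK).trans_lt hx.2)

theorem schattenNorm_le_of_tendsto (hp : 0 < p) {y : ℕ → BEllTwo}
    (hlim : Filter.Tendsto y Filter.atTop (nhds x)) {c : ℝ≥0∞}
    (hc : ∀ n, schattenNorm p (y n) ≤ c) : schattenNorm p x ≤ c := by
  rw [schattenNorm_eq, one_div, ENNReal.rpow_inv_le_iff hp]
  refine basisTrace_rpow_le_of_tendsto ellBasis (fun n => star_mul_self_nonneg (y n))
    (star_mul_self_nonneg x) (hlim.star.mul hlim) (by positivity) fun n => ?_
  rw [← ENNReal.rpow_inv_le_iff hp, ← one_div]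
  exact hc n

/-- The Berezin–Jensen inequality puts `K` outside the power, where it only weights the diagonal
entries of `(x x*)^(p/2)`. For `x` in `S^p` these entries are summable, so weights tending to 0
pointwise and boundedly make the bound small. -/
theorem schattenNorm_isDiagonal_mul_le (hp : 2 ≤ p) (hx : IsCompactOperator x) {K : BEllTwo}
    {d : ℕ → ℝ} (hK : IsDiagonal K d) (hd : ∀ j, |d j| ≤ 1) :
    schattenNorm p (K * x) ≤ (∑' j, ENNReal.ofReal (d j ^ 2) * ENNReal.ofReal
      (inner ℂ (ellBasis j) (((x * star x) ^ (p / 2)) (ellBasis j))).re) ^ (1 / p) := by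
  refine ENNReal.rpow_le_rpow ((basisTrace_rpow_star_mul_le ellBasis hx (hK.norm_le hd)
    (by linarith)).trans (le_of_eq ?_)) (by positivity)
  refine tsum_congr fun j => ?_
  rw [← ENNReal.ofReal_mul (by positivity), hK.isSelfAdjoint.star_eq]
  congr 1
  have h1 : (K * (x * star x) ^ (p / 2) * K : BEllTwo) (ellBasis j)
      = K (((x * star x) ^ (p / 2) : BEllTwo) (K (ellBasis j))) := rfl
  rw [h1, ← ContinuousLinearMap.adjoint_inner_left, ← ContinuousLinearMap.star_eq_adjoint,
    hK.isSelfAdjoint.star_eq, hK.apply_ellBasis, map_smul, inner_smul_left, inner_smul_right,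
    Complex.conj_ofReal, Complex.re_ofReal_mul, Complex.re_ofReal_mul]
  ring

end Schatten

/-! ### Square functions of multiplication operators. -/

section SquareFunction

variable {p : ℝ} {x : BEllTwo}

theorem leftMul_pow_apply (b y : BEllTwo) (n : ℕ) : (leftMul b ^ n) y = b ^ n * y := by
  rw [leftMul, LinearMap.pow_mulLeft, LinearMap.mulLeft_apply]

theorem rightMul_pow_apply (b y : BEllTwo) (n : ℕ) : (rightMul b ^ n) y = y * b ^ n := by
  rw [rightMul, LinearMap.pow_mulRight, LinearMap.mulRight_apply]

theorem squareSeq_leftMul (b x : BEllTwo) (j : ℕ) :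
    squareSeq (leftMul b) x j = ((Real.sqrt ((j : ℝ) + 1) : ℝ) : ℂ) • (b ^ j * (1 - b) * x) := by
  rw [squareSeq, leftMul_pow_apply]
  simp [leftMul, mul_sub, sub_mul, mul_assoc]

theorem squareSeq_rightMul {b : BEllTwo} (hb : IsSelfAdjoint b) (x : BEllTwo) (j : ℕ) :
    squareSeq (rightMul b) x j = star (squareSeq (leftMul b) (star x) j) := by
  rw [squareSeq_leftMul, squareSeq, rightMul_pow_apply]
  simp only [star_smul, star_mul, star_star, star_sub, star_one, star_pow, hb.star_eq,
    Complex.star_def, Complex.conj_ofReal]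
  congr 1
  simp [rightMul, mul_sub, sub_mul, mul_assoc]

theorem rowNorm_star (hp : 2 ≤ p) (y : ℕ → BEllTwo) :
    rowNorm p (fun k => star (y k)) = colNorm p y := by
  have h1 (s : Finset ℕ) : finRowNorm p s (fun k => star (y k)) = finColNorm p s y := by
    simp [finRowNorm, finColNorm]
  have h2 : MemRow p (fun k => star (y k)) ↔ MemCol p y := by
    simp only [MemRow, MemCol, h1]
    refine and_congr_left fun _ => forall_congr' fun k => ⟨fun h => ?_, star_mem_schattenClass hp⟩
    simpa using star_mem_schattenClass hp h
  simp only [rowNorm, colNorm, h1]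
  by_cases h : MemCol p y
  · rw [if_pos h, if_pos (h2.mpr h)]
  · rw [if_neg h, if_neg (h2.not.mpr h)]

theorem rowSquare_rightMul (hp : 2 ≤ p) {b : BEllTwo} (hb : IsSelfAdjoint b) (x : BEllTwo) :
    rowSquare p (rightMul b) x = colSquare p (leftMul b) (star x) := by
  rw [rowSquare, colSquare, ← rowNorm_star hp]
  exact congrArg _ (funext (squareSeq_rightMul hb x))

/-- The differentiated geometric series `∑ (k+1) r^k = (1-r)⁻²` at `r = l²`, multiplied by `(1-l)²`.
-/
theorem hasSum_succ_mul_pow {l : ℝ} (h0 : 0 ≤ l) (h1 : l < 1) :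
    HasSum (fun k : ℕ => ((k : ℝ) + 1) * (l ^ k * (1 - l)) ^ 2) ((1 + l)⁻¹ ^ 2) := by
  have hl2 : ‖l ^ 2‖ < 1 := by
    rw [Real.norm_of_nonneg (by positivity)]
    exact pow_lt_one₀ h0 h1 two_ne_zero
  have h := (hasSum_choose_mul_geometric_of_norm_lt_one 1 hl2).mul_right ((1 - l) ^ 2)
  have h2 : 1 / (1 - l ^ 2) ^ (1 + 1) * (1 - l) ^ 2 = (1 + l)⁻¹ ^ 2 := by
    have h3 : 1 - l ≠ 0 := by linarith
    have h4 : 1 + l ≠ 0 := by positivity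
    rw [show 1 - l ^ 2 = (1 - l) * (1 + l) by ring]
    rw [mul_pow]
    field_simp
  rw [h2] at h
  refine (congrArg (HasSum · _ _) (funext fun k => ?_)).mp h
  rw [Nat.choose_one_right]
  push_cast
  ring

theorem colSquare_leftMul_of_isDiagonal (hp : 2 ≤ p) (hx : x ∈ schattenClass p) {b K : BEllTwo}
    {l : ℕ → ℝ} (hb : IsDiagonal b l) (h0 : ∀ j, 0 ≤ l j) (h1 : ∀ j, l j < 1)
    (hK : IsDiagonal K fun j => (1 + l j)⁻¹) :
    colSquare p (leftMul b) x = schattenNorm p (K * x) := by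
  have hp0 : 0 < p := by linarith
  let m (k j : ℕ) : ℝ := l j ^ k * (1 - l j)
  have hm (k : ℕ) : IsDiagonal (b ^ k * (1 - b)) (m k) := (hb.pow k).mul (IsDiagonal.one.sub hb)
  have hm0 (k j : ℕ) : 0 ≤ m k j :=
    mul_nonneg (pow_nonneg (h0 j) k) (sub_nonneg.mpr (h1 j).le)
  have hm1 (k j : ℕ) : |m k j| ≤ 1 := by
    rw [abs_of_nonneg (hm0 k j)]
    exact mul_le_one₀ (pow_le_one₀ (h0 j) (h1 j).le) (sub_nonneg.mpr (h1 j).le)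
      (by linarith [h0 j])
  let w (s : Finset ℕ) (j : ℕ) : ℝ := ∑ k ∈ s, ((k : ℝ) + 1) * m k j ^ 2
  have hw0 (s : Finset ℕ) (j : ℕ) : 0 ≤ w s j := Finset.sum_nonneg fun k _ => by positivity
  have hsum (j : ℕ) : HasSum (fun k : ℕ => ((k : ℝ) + 1) * m k j ^ 2) ((1 + l j)⁻¹ ^ 2) :=
    hasSum_succ_mul_pow (h0 j) (h1 j)
  have hwle (s : Finset ℕ) (j : ℕ) : w s j ≤ (1 + l j)⁻¹ ^ 2 :=
    sum_le_hasSum s (fun k _ => by positivity) (hsum j)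
  have hK0 (j : ℕ) : 0 ≤ (1 + l j)⁻¹ := inv_nonneg.mpr (by linarith [h0 j])
  have hK1 (j : ℕ) : (1 + l j)⁻¹ ≤ 1 := inv_le_one_of_one_le₀ (by linarith [h0 j])
  have hsqrt (s : Finset ℕ) (j : ℕ) : √(w s j) ≤ (1 + l j)⁻¹ :=
    (Real.sqrt_le_left (hK0 j)).mpr (hwle s j)
  have hsqrt1 (s : Finset ℕ) (j : ℕ) : |√(w s j)| ≤ 1 := by
    rw [abs_of_nonneg (Real.sqrt_nonneg _)]
    exact (hsqrt s j).trans (hK1 j)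
  -- `F s` is the positive square root of the diagonal operator with entries `w s j`.
  choose F hF using fun s => exists_isDiagonal (hsqrt1 s)
  have hfin (s : Finset ℕ) : finColNorm p s (squareSeq (leftMul b) x)
      = schattenNorm p (F s * x) := by
    rw [finColNorm, ← schattenNorm_sqrt_star_mul_self p (F s * x)]
    congr 2
    have h2 (k : ℕ) : star (squareSeq (leftMul b) x k) * squareSeq (leftMul b) x k
        = star x * ((((k : ℝ) + 1 : ℝ) : ℂ) • (b ^ k * (1 - b) * (b ^ k * (1 - b)))) * x := by
      rw [squareSeq_leftMul, star_smul, smul_mul_smul_comm, star_mul, (hm k).isSelfAdjoint.star_eq,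
        Complex.star_def, Complex.conj_ofReal, ← Complex.ofReal_mul,
        Real.mul_self_sqrt (by positivity), mul_smul_comm, smul_mul_assoc]
      noncomm_ring
    simp_rw [h2]
    rw [← Finset.sum_mul, ← Finset.mul_sum, star_mul, (hF s).isSelfAdjoint.star_eq,
      show star x * F s * (F s * x) = star x * (F s * F s) * x by noncomm_ring]
    congr 2
    refine (IsDiagonal.sum s fun k => ((hm k).mul (hm k)).smul _).ext ((hF s).mul (hF s))
      fun j => ?_
    rw [Real.mul_self_sqrt (hw0 s j)]
    exact Finset.sum_congr rfl fun k _ => by rw [sq]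
  have hmem : MemCol p (squareSeq (leftMul b) x) := by
    refine ⟨fun k => ?_, fun ε hε => ?_⟩
    · rw [squareSeq_leftMul]
      exact smul_mul_mem_schattenClass hp hx ((hm k).norm_le (hm1 k)) (Real.sqrt_nonneg _)
    let t (j : ℕ) : ℝ≥0∞ := ENNReal.ofReal
      (inner ℂ (ellBasis j) (((x * star x) ^ (p / 2)) (ellBasis j))).re
    have ht : ∑' j, t j ≠ ∞ := by
      have h3 : schattenNorm p x = (∑' j, t j) ^ (1 / p) := by
        rw [schattenNorm_eq, basisTrace_rpow_comm _ _ (by linarith)]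
        rfl
      intro h4
      have h5 := hx.2
      rw [h3, h4, ENNReal.top_rpow_of_pos (by positivity)] at h5
      exact h5.ne rfl
    let r (n j : ℕ) : ℝ := (1 + l j)⁻¹ ^ 2 - w (Finset.range n) j
    have hr (j : ℕ) : Filter.Tendsto (fun n => r n j) Filter.atTop (nhds 0) := by
      have h3 := (hsum j).tendsto_sum_nat.const_sub ((1 + l j)⁻¹ ^ 2)
      rwa [sub_self] at h3
    have hr1 (n j : ℕ) : r n j ≤ 1 := by
      have := pow_le_one₀ (n := 2) (hK0 j) (hK1 j)
      have := hw0 (Finset.range n) j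
      simp only [r]
      linarith
    have htail : Filter.Tendsto (fun n => ∑' j, ENNReal.ofReal (r n j) * t j) Filter.atTop
        (nhds 0) := by
      -- Dominated convergence for the counting measure, with the summable sequence `t` as majorant.
      have h6 := MeasureTheory.tendsto_lintegral_of_dominated_convergence
        (μ := MeasureTheory.Measure.count) (F := fun n j => ENNReal.ofReal (r n j) * t j)
        (f := fun _ => 0) t (fun _ => measurable_of_countable _) (fun n => .of_forall fun j => ?_)
        (by rwa [MeasureTheory.lintegral_count]) (.of_forall fun j => ?_)
      · simpa [MeasureTheory.lintegral_count] using h6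
      · exact mul_le_of_le_one_left zero_le (by simpa using hr1 n j)
      · have h7 := ENNReal.Tendsto.mul_const (b := t j)
          ((ENNReal.continuous_ofReal.tendsto 0).comp (hr j))
          (Or.inr (ENNReal.ne_top_of_tsum_ne_top ht j))
        simpa using h7
    have htail' : Filter.Tendsto (fun n => (∑' j, ENNReal.ofReal (r n j) * t j) ^ (1 / p))
        Filter.atTop (nhds 0) := by
      have h8 := ((ENNReal.continuous_rpow_const (y := 1 / p)).tendsto 0).comp htail
      rwa [ENNReal.zero_rpow_of_pos (by positivity)] at h8
    obtain ⟨N, hN⟩ := Filter.eventually_atTop.mp (htail'.eventually_lt_const hε)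
    refine ⟨N, fun i n hi hin => lt_of_le_of_lt ?_ (hN i hi)⟩
    rw [hfin]
    refine (schattenNorm_isDiagonal_mul_le hp hx.1 (hF _) (hsqrt1 _)).trans ?_
    refine ENNReal.rpow_le_rpow (ENNReal.tsum_le_tsum fun j => ?_) (by positivity)
    gcongr
    rw [Real.sq_sqrt (hw0 _ j)]
    -- The block from `i` to `n` is at most the tail `r i j`, uniformly in `n`.
    have h9 : w (Finset.range i) j + w (Finset.Ico i n) j = w (Finset.range n) j :=
      Finset.sum_range_add_sum_Ico _ hin
    have h10 := hwle (Finset.range n) j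
    simp only [r]
    linarith
  rw [colSquare, colNorm, if_pos hmem]
  simp_rw [hfin]
  refine le_antisymm (iSup_le fun n => ?_) ?_
  -- Upper bound: `F = S K` with `S` a diagonal contraction, since `√w ≤ (1 + l)⁻¹`.
  · have hg (j : ℕ) : |√(w (Finset.range n) j) * (1 + l j)| ≤ 1 := by
      have h2 : 0 < 1 + l j := by linarith [h0 j]
      rw [abs_of_nonneg (by positivity), ← le_div_iff₀ h2, one_div]
      exact hsqrt _ j
    obtain ⟨S, hS⟩ := exists_isDiagonal hg
    have h3 : F (Finset.range n) = S * K := (hF _).ext (hS.mul hK) fun j => by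
      have h2 : 1 + l j ≠ 0 := by linarith [h0 j]
      rw [mul_assoc, mul_inv_cancel₀ h2, mul_one]
    rw [h3, mul_assoc]
    exact schattenNorm_mul_le hp (hx.1.clm_comp K) (hS.norm_le hg)
  -- Lower bound: `F → K` strongly, hence `F x → K x` in norm, and the Schatten norm is lower
  -- semicontinuous.
  · have hdist (n j : ℕ) : |√(w (Finset.range n) j) - (1 + l j)⁻¹| ≤ 1 := by
      rw [abs_le]
      constructor
      · linarith [Real.sqrt_nonneg (w (Finset.range n) j), hK1 j]
      · linarith [hsqrt (Finset.range n) j]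
    have hlim (j : ℕ) : Filter.Tendsto (fun n => √(w (Finset.range n) j)) Filter.atTop
        (nhds (1 + l j)⁻¹) := by
      have h4 := (Real.continuous_sqrt.tendsto _).comp (hsum j).tendsto_sum_nat
      rwa [Real.sqrt_sq (hK0 j)] at h4
    refine schattenNorm_le_of_tendsto hp0
      (tendsto_clm_mul_of_isCompactOperator hx.1
        (fun n => ((hF (Finset.range n)).sub hK).norm_le (hdist n))
        (IsDiagonal.tendsto_apply (fun n => hF (Finset.range n)) hK hdist hlim))
      fun n => le_iSup (fun n => schattenNorm p (F (Finset.range n) * x)) n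

theorem diagEntry_nonneg (j : ℕ) : 0 ≤ diagEntry j :=
  sub_nonneg.mpr (inv_le_one_of_one_le₀ (one_le_pow₀ one_le_two))

theorem diagEntry_lt_one (j : ℕ) : diagEntry j < 1 :=
  sub_lt_self _ (by positivity)

theorem colSquare_leftMul_diagOp_bounds (hp : 2 ≤ p) (hx : x ∈ schattenClass p) :
    2⁻¹ * schattenNorm p x ≤ colSquare p (leftMul diagOp) x ∧
      colSquare p (leftMul diagOp) x ≤ schattenNorm p x := by
  have hK1 (j : ℕ) : |(1 + diagEntry j)⁻¹| ≤ 1 := by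
    have := diagEntry_nonneg j
    rw [abs_of_nonneg (by positivity)]
    exact inv_le_one_of_one_le₀ (by linarith)
  obtain ⟨K, hK⟩ := exists_isDiagonal hK1
  rw [colSquare_leftMul_of_isDiagonal hp hx isDiagonal_diagOp diagEntry_nonneg diagEntry_lt_one hK]
  refine ⟨?_, schattenNorm_mul_le hp hx.1 (hK.norm_le hK1)⟩
  -- The contraction `(1 + a)/2` maps `K x` to `x/2`, whence the constant `1/2`.
  have hS := (IsDiagonal.one.add isDiagonal_diagOp).smul 2⁻¹
  have hS1 (j : ℕ) : |2⁻¹ * (1 + diagEntry j)| ≤ 1 := by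
    have := diagEntry_nonneg j
    have := diagEntry_lt_one j
    rw [abs_of_nonneg (by positivity)]
    linarith
  have h1 : (((2⁻¹ : ℝ) : ℂ) • (1 + diagOp) * K : BEllTwo) = ((2⁻¹ : ℝ) : ℂ) • 1 :=
    (hS.mul hK).ext (IsDiagonal.one.smul 2⁻¹) fun j => by
      have := diagEntry_nonneg j
      field_simp
  have h2 : schattenNorm p ((((2⁻¹ : ℝ) : ℂ) • (1 + diagOp)) * (K * x)) ≤ schattenNorm p (K * x) :=
    schattenNorm_mul_le hp (hx.1.clm_comp K) (hS.norm_le hS1)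
  rw [← mul_assoc, h1, smul_mul_assoc, one_mul, schattenNorm_smul (by linarith) (by norm_num)] at h2
  rwa [ENNReal.ofReal_inv_of_pos two_pos, ENNReal.ofReal_ofNat] at h2

end SquareFunction

theorem lemma4p2 (p : ℝ) (hp : 2 ≤ p) (x : BEllTwo) (hx : x ∈ schattenClass p) :
    (2⁻¹ * schattenNorm p x ≤ colSquare p (leftMul diagOp) x ∧
      colSquare p (leftMul diagOp) x ≤ schattenNorm p x) ∧
    (2⁻¹ * schattenNorm p x ≤ rowSquare p (rightMul diagOp) x ∧
      rowSquare p (rightMul diagOp) x ≤ schattenNorm p x) ∧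
    ∀ ρ : ℝ, 0 < ρ → ρ < 1 →
      IsUnit (1 + (ρ : ℂ) • diagOp) ∧
      colSquare p ((ρ : ℂ) • leftMul diagOp) x =
        schattenNorm p (Ring.inverse (1 + (ρ : ℂ) • diagOp) * x) := by
  refine ⟨colSquare_leftMul_diagOp_bounds hp hx, ?_, fun ρ h0 h1 => ?_⟩
  · rw [rowSquare_rightMul hp isDiagonal_diagOp.isSelfAdjoint, ← schattenNorm_star hp x]
    exact colSquare_leftMul_diagOp_bounds hp (star_mem_schattenClass hp hx)
  · have hl0 (j : ℕ) : 0 ≤ ρ * diagEntry j := mul_nonneg h0.le (diagEntry_nonneg j)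
    have hl1 (j : ℕ) : ρ * diagEntry j < 1 :=
      mul_lt_one_of_nonneg_of_lt_one_left h0.le h1 (diagEntry_lt_one j).le
    have hb := isDiagonal_diagOp.smul ρ
    have hK1 (j : ℕ) : |(1 + ρ * diagEntry j)⁻¹| ≤ 1 := by
      have := hl0 j
      rw [abs_of_nonneg (by positivity)]
      exact inv_le_one_of_one_le₀ (by linarith)
    obtain ⟨K, hK⟩ := exists_isDiagonal hK1
    have hne (j : ℕ) : 1 + ρ * diagEntry j ≠ 0 := by linarith [hl0 j]
    -- `Ring.inverse` takes the default value 0 off the units, so it is identified with `K` through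
    -- an explicit unit.
    let u : BEllTwoˣ :=
      ⟨1 + (ρ : ℂ) • diagOp, K,
        ((IsDiagonal.one.add hb).mul hK).ext .one fun j => mul_inv_cancel₀ (hne j),
        (hK.mul (IsDiagonal.one.add hb)).ext .one fun j => inv_mul_cancel₀ (hne j)⟩
    have hu : (1 + (ρ : ℂ) • diagOp : BEllTwo) = u := rfl
    refine ⟨hu ▸ u.isUnit, ?_⟩
    have h2 : (ρ : ℂ) • leftMul diagOp = leftMul ((ρ : ℂ) • diagOp) := by
      ext y v
      simp [leftMul]
    rw [hu, Ring.inverse_unit, h2]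
    exact colSquare_leftMul_of_isDiagonal hp hx hb hl0 hl1 hK
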